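/- Let $\Sigma$ be a many-sorted first-order signature, with denumerably many variables of every sort, and let $\mathcal C$ be a Heyting category: finite limits, images stable under pullback, finite joins of subobjects preserved by the pullback functors $f^*$, and right adjoints $\forall_f$ of all $f^*:\mathrm{Sub}(b)\to\mathrm{Sub}(a)$. Let $M$ be a $\Sigma$-structure in $\mathcal C$ (an object $Ms$ for each sort, an arrow for each function symbol, a subobject for each relation symbol), and assume that each $Ms$ is well-supported, i.e. the image of $Ms\to 1$ is $1$. For a formula $\varphi$ and a finite set of variables (context) $\vec x\supseteq \mathrm{FV}(\varphi)$, let $[\![\vec x.\varphi]\!]\in\mathrm{Sub}_{\mathcal C}(M\vec x)$ be the usual interpretation, where $M\vec x=\prod_{x:s\in\vec x}Ms$. Formulas are written with named variables, substitution $A[t/x]$ is capture-avoiding, and a bound variable that already occurs in the context is renamed. Let $\mathrm{LD}(M)=\langle\mathbb D,N\rangle$: the objects of $\mathbb D$ are the interpretations $N\varphi=[\![\mathrm{FV}(\varphi).\varphi]\!]$ of formulas, each taken together with its context $\mathrm{FV}(\varphi)$; between two objects there is at most one arrow, and there is an arrow $N\varphi\to N\psi$ exactly when $[\![\vec z.\varphi]\!]\le[\![\vec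 z.\psi]\!]$ in $\mathrm{Sub}_{\mathcal C}(M\vec z)$, where $\vec z=\mathrm{FV}(\varphi)\cup\mathrm{FV}(\psi)$. Then this relation is reflexive and transitive, so that $\mathbb D$ is a category, and: **(A)** $\langle\mathbb D,N\rangle$ is logically distributive, that is: 1. $\mathbb D$ has finite products, finite coproducts and exponentials, and all canonical arrows $(X\times Y)+(X\times Z)\to X\times(Y+Z)$ are invertible. 2. $N\bot$ is initial, $N\top$ is terminal, $N(A\wedge B)$ is a product $NA\times NB$, $N(A\vee B)$ is a coproduct $NA+NB$, and $N(A\supset B)$ is an exponential $NB^{NA}$. 3. For every variable $x:s$ and formula $A$, let $\mathbb D_{\forall x.A}$ be the category whose objects are the cones on the family $(N(A[t/x]))_t$, with $t$ ranging over all terms of sort $s$, whose vertex is of the form $NB$ with $x\notin\mathrm{FV}(B)$, and whose arrows are, apart from identities, the arrows of cones whose codomain has vertex $N(\forall x.A)$. It has a terminal object, with vertex $N(\forall x.A)$. Dually, let $\mathbb D_{\exists x.A}$ be the category whose objects are the cocones on the same family with vertex of the form $NB$, $x\notin\mathrm{FV}(B)$, and whose arrows are, apart from identities, the arrows of cocones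 whose domain has vertex $N(\exists x.A)$. It has an initial object, with vertex $N(\exists x.A)$. 4. If $x\notin\mathrm{FV}(A)$, then the unique arrow $N(\exists x.A\wedge B)\to NA\times N(\exists x.B)$ of $\mathbb D_{\exists x.A\wedge B}$ is invertible, where its codomain carries the cocone $(1_{NA}\times\delta_t)_t$ and $(\delta_t)_t$ is the cocone of $N(\exists x.B)$. **(B)** For all formulas $\varphi,\psi$ and every finite context $\vec x\supseteq\mathrm{FV}(\varphi)\cup\mathrm{FV}(\psi)$, the sequent $\varphi\vdash_{\vec x}\psi$ is valid in $M$, i.e. $[\![\vec x.\varphi]\!]\le[\![\vec x.\psi]\!]$, if and only if it is valid in $\mathrm{LD}(M)$, i.e. there is an arrow $N\varphi\to N\psi$ in $\mathbb D$. -/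

import Mathlib

open CategoryTheory CategoryTheory.Limits

universe u v w

noncomputable section

namespace LogDist

/-! ### Syntax of multi-sorted first-order logic -/

/-- A multi-sorted first-order signature. The decorations of a function symbol `f` are
`f : s_1 × ⋯ × s_n → s_0`, those of a relation symbol `r` are `r : s_1 × ⋯ × s_n`. -/
structure LogicalSignature where
  /-- sort symbols -/
  Srt : Type u
  /-- function symbols -/
  Fn : Type u
  fnArity : Fn → ℕ
  fnDom : (f : Fn) → Fin (fnArity f) → Srt
  fnCod : Fn → Srt
  /-- relation symbols -/
  Rel : Type u
  relArity : Rel → ℕ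
  relDom : (r : Rel) → Fin (relArity r) → Srt

/-- Variables: every sort has a denumerable set of them. -/
@[ext]
structure Var (Sg : LogicalSignature.{u}) where
  sort : Sg.Srt
  idx : ℕ

instance (Sg : LogicalSignature.{u}) : DecidableEq (Var Sg) := Classical.decEq _

/-- Logical terms, indexed by their sort. -/
inductive Term (Sg : LogicalSignature.{u}) : Sg.Srt → Type u
  | var (x : Var Sg) : Term Sg x.sort
  | app (f : Sg.Fn) (ts : (i : Fin (Sg.fnArity f)) → Term Sg (Sg.fnDom f i)) :
      Term Sg (Sg.fnCod f)

/-- Logical formulae; they are identified with the lambda-types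
(`⊥, ⊤, ∧, ∨, ⊃` being written `0, 1, ×, +, →` there). -/
inductive Formula (Sg : LogicalSignature.{u}) : Type u
  | top : Formula Sg
  | bot : Formula Sg
  | rel (r : Sg.Rel) (ts : (i : Fin (Sg.relArity r)) → Term Sg (Sg.relDom r i)) : Formula Sg
  | and (A B : Formula Sg) : Formula Sg
  | or (A B : Formula Sg) : Formula Sg
  | imp (A B : Formula Sg) : Formula Sg
  | all (x : Var Sg) (A : Formula Sg) : Formula Sg
  | ex (x : Var Sg) (A : Formula Sg) : Formula Sg

variable {Sg : LogicalSignature.{u}}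

/-- Free variables of a term. -/
def Term.FV : {s : Sg.Srt} → Term Sg s → Finset (Var Sg)
  | _, .var x => {x}
  | _, .app _ ts => Finset.univ.biUnion fun i => (ts i).FV

/-- Free variables of a formula. -/
def Formula.FV : Formula Sg → Finset (Var Sg)
  | .top => ∅
  | .bot => ∅
  | .rel _ ts => Finset.univ.biUnion fun i => (ts i).FV
  | .and A B => A.FV ∪ B.FV
  | .or A B => A.FV ∪ B.FV
  | .imp A B => A.FV ∪ B.FV
  | .all x A => A.FV.erase x
  | .ex x A => A.FV.erase x

/-- Substitutions of logical variables by terms of the same sort. -/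
abbrev Subst (Sg : LogicalSignature.{u}) : Type u := (x : Var Sg) → Term Sg x.sort

/-- Simultaneous substitution in a term. -/
def Term.subst (σ : Subst Sg) : {s : Sg.Srt} → Term Sg s → Term Sg s
  | _, .var x => σ x
  | _, .app f ts => .app f fun i => (ts i).subst σ

/-- The index of the bound variable after substituting with `σ` under a quantifier that binds `x`,
where `F` is the set of free variables of the quantified formula: `x` is kept unless it
would capture a variable of a substituted term, in which case it is replaced by a fresh
variable of the same sort. -/
def freshIdx (σ : Subst Sg) (F : Finset (Var Sg)) (x : Var Sg) : ℕ :=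
  if x ∈ F.biUnion (fun y => (σ y).FV)
    then (F.biUnion fun y => (σ y).FV).sup Var.idx + 1 else x.idx

/-- The substitution to use under a quantifier whose bound variable `x` gets the index
`freshIdx σ F x`. -/
def Subst.lift (σ : Subst Sg) (F : Finset (Var Sg)) (x : Var Sg) : Subst Sg :=
  Function.update σ x (Term.var ⟨x.sort, freshIdx σ F x⟩)

/-- Simultaneous capture-avoiding substitution in a formula. -/
def Formula.subst : Formula Sg → Subst Sg → Formula Sg
  | .top, _ => .top
  | .bot, _ => .bot
  | .rel r ts, σ => .rel r fun i => (ts i).subst σ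
  | .and A B, σ => .and (A.subst σ) (B.subst σ)
  | .or A B, σ => .or (A.subst σ) (B.subst σ)
  | .imp A B, σ => .imp (A.subst σ) (B.subst σ)
  | .all x A, σ => .all ⟨x.sort, freshIdx σ (A.FV.erase x) x⟩ (A.subst (σ.lift (A.FV.erase x) x))
  | .ex x A, σ => .ex ⟨x.sort, freshIdx σ (A.FV.erase x) x⟩ (A.subst (σ.lift (A.FV.erase x) x))

/-- The formula `A[t/x]`. -/
def Formula.inst (A : Formula Sg) (x : Var Sg) (t : Term Sg x.sort) : Formula Sg :=
  A.subst (Function.update Term.var x t)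

theorem Term.subst_eq_self {σ : Subst Sg} : {s : Sg.Srt} → (t : Term Sg s) →
    (∀ y ∈ t.FV, σ y = Term.var y) → t.subst σ = t
  | _, .var x, h => h x (by simp [Term.FV])
  | _, .app f ts, h => by
      simp only [Term.subst, Term.app.injEq]
      funext i
      exact Term.subst_eq_self (ts i) fun y hy =>
        h y (by simp only [Term.FV, Finset.mem_biUnion]; exact ⟨i, Finset.mem_univ _, hy⟩)

theorem freshIdx_eq_self {σ : Subst Sg} {F : Finset (Var Sg)} {x : Var Sg} (hx : x ∉ F)
    (h : ∀ y ∈ F, σ y = Term.var y) : freshIdx σ F x = x.idx := by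
  have : x ∉ F.biUnion (fun y => (σ y).FV) := by
    simp only [Finset.mem_biUnion, not_exists, not_and]
    intro y hy hxy
    rw [h y hy] at hxy
    simp only [Term.FV, Finset.mem_singleton] at hxy
    exact hx (hxy ▸ hy)
  simp only [freshIdx, if_neg this]

theorem Subst.lift_eq_var {σ : Subst Sg} {F : Finset (Var Sg)} {x y : Var Sg}
    (h : ∀ y ∈ F.erase x, σ y = Term.var y) (hy : y ∈ F) :
    σ.lift (F.erase x) x y = Term.var y := by
  unfold Subst.lift
  by_cases hyx : y = x
  · subst hyx
    rw [freshIdx_eq_self (by simp) h]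
    simp
  · rw [Function.update_of_ne hyx]
    exact h y (Finset.mem_erase.2 ⟨hyx, hy⟩)

theorem Formula.subst_eq_self (A : Formula Sg) : ∀ {σ : Subst Sg},
    (∀ y ∈ A.FV, σ y = Term.var y) → A.subst σ = A := by
  induction A with
  | top => intros; rfl
  | bot => intros; rfl
  | rel r ts =>
    intro σ h
    simp only [Formula.subst, Formula.rel.injEq, heq_eq_eq, true_and]
    funext i
    exact Term.subst_eq_self (ts i) fun y hy =>
      h y (by simp only [Formula.FV, Finset.mem_biUnion]; exact ⟨i, Finset.mem_univ _, hy⟩)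
  | and A B ihA ihB | or A B ihA ihB | imp A B ihA ihB =>
    intro σ h
    simp only [Formula.FV, Finset.mem_union] at h
    simp only [Formula.subst]
    rw [ihA fun y hy => h y (Or.inl hy), ihB fun y hy => h y (Or.inr hy)]
  | all x A ih | ex x A ih =>
    intro σ h
    simp only [Formula.FV] at h
    simp only [Formula.subst]
    rw [freshIdx_eq_self (by simp) h, ih fun y hy => Subst.lift_eq_var h hy]

/-- Substituting for a variable that is not free does nothing. -/
theorem Formula.inst_of_notMem {A : Formula Sg} {x : Var Sg} (hx : x ∉ A.FV)
    (t : Term Sg x.sort) : A.inst x t = A :=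
  A.subst_eq_self fun y hy => Function.update_of_ne (fun h : y = x => hx (h ▸ hy)) _ _

/-! ### Logically distributive categories -/

section LogicallyDistributive

variable {D : Type v} [Category.{w} D]

/-- `E` with the evaluation `ev : E × A ⟶ B` is the exponential object `B ^ A`. -/
def IsExponential [HasFiniteProducts D] (A B E : D) (ev : E ⨯ A ⟶ B) : Prop :=
  ∀ (X : D) (f : X ⨯ A ⟶ B), ∃! g : X ⟶ E, prod.map g (𝟙 A) ≫ ev = f

/-- The functor `t ↦ N (A[t/x])` from the discrete category of the terms of the sort of `x`. -/
abbrev glue (N : Formula Sg → D) (x : Var Sg) (A : Formula Sg) :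
    Discrete (Term Sg x.sort) ⥤ D :=
  Discrete.functor fun t => N (A.inst x t)

/-- The objects of the category `D_(∀ x. A)`: vertexes of cones on `t ↦ N (A[t/x])`, together
with the cone, such that the vertex is of the form `N B` with `x` not free in `B`. -/
structure ForallCat (N : Formula Sg → D) (x : Var Sg) (A : Formula Sg) where
  cone : Cone (glue N x A)
  exists_pt : ∃ B : Formula Sg, x ∉ B.FV ∧ cone.pt = N B

/-- The arrows of `D_(∀ x. A)`: apart from identities, the arrows of cones whose codomain has
the vertex `N (∀ x. A)`. -/
structure ForallCat.Hom {N : Formula Sg → D} {x : Var Sg} {A : Formula Sg}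
    (X Y : ForallCat N x A) where
  hom : X.cone ⟶ Y.cone
  property : Y.cone.pt = N (.all x A) ∨
    ∃ h : X = Y, hom = eqToHom (congrArg ForallCat.cone h)

instance {N : Formula Sg → D} {x : Var Sg} {A : Formula Sg} : Category (ForallCat N x A) where
  Hom X Y := ForallCat.Hom X Y
  id X := ⟨𝟙 X.cone, Or.inr ⟨rfl, rfl⟩⟩
  comp {X Y Z} f g := ⟨f.hom ≫ g.hom, by
    rcases g.property with h | ⟨h, hg⟩
    · exact Or.inl h
    · subst h
      rcases f.property with h | ⟨h, hf⟩
      · exact Or.inl h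
      · subst h
        exact Or.inr ⟨rfl, by simp [hf, hg]⟩⟩
  id_comp f := by simp
  comp_id f := by simp
  assoc f g h := by simp

/-- The objects of the category `D_(∃ x. A)`: vertexes of co-cones on `t ↦ N (A[t/x])`, together
with the co-cone, such that the vertex is of the form `N B` with `x` not free in `B`. -/
structure ExistsCat (N : Formula Sg → D) (x : Var Sg) (A : Formula Sg) where
  cocone : Cocone (glue N x A)
  exists_pt : ∃ B : Formula Sg, x ∉ B.FV ∧ cocone.pt = N B

/-- The arrows of `D_(∃ x. A)`: apart from identities, the arrows of co-cones whose domain has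
the vertex `N (∃ x. A)`. -/
structure ExistsCat.Hom {N : Formula Sg → D} {x : Var Sg} {A : Formula Sg}
    (X Y : ExistsCat N x A) where
  hom : X.cocone ⟶ Y.cocone
  property : X.cocone.pt = N (.ex x A) ∨
    ∃ h : X = Y, hom = eqToHom (congrArg ExistsCat.cocone h)

instance {N : Formula Sg → D} {x : Var Sg} {A : Formula Sg} : Category (ExistsCat N x A) where
  Hom X Y := ExistsCat.Hom X Y
  id X := ⟨𝟙 X.cocone, Or.inr ⟨rfl, rfl⟩⟩
  comp {X Y Z} f g := ⟨f.hom ≫ g.hom, by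
    rcases f.property with h | ⟨h, hf⟩
    · exact Or.inl h
    · subst h
      rcases g.property with h | ⟨h, hg⟩
      · exact Or.inl h
      · subst h
        exact Or.inr ⟨rfl, by simp [hf, hg]⟩⟩
  id_comp f := by simp
  comp_id f := by simp
  assoc f g h := by simp

/-- The object of `D_(∀ x. A)` with vertex `N (∀ x. A)` and projections `p`. -/
def forallObj (N : Formula Sg → D) (x : Var Sg) (A : Formula Sg)
    (p : (t : Term Sg x.sort) → N (.all x A) ⟶ N (A.inst x t)) : ForallCat N x A where
  cone := Fan.mk (N (.all x A)) p
  exists_pt := ⟨.all x A, by simp [Formula.FV], rfl⟩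

/-- The object of `D_(∃ x. A)` with vertex `N (∃ x. A)` and injections `j`. -/
def existsObj (N : Formula Sg → D) (x : Var Sg) (A : Formula Sg)
    (j : (t : Term Sg x.sort) → N (A.inst x t) ⟶ N (.ex x A)) : ExistsCat N x A where
  cocone := Cofan.mk (N (.ex x A)) j
  exists_pt := ⟨.ex x A, by simp [Formula.FV], rfl⟩

/-- The data showing that the category `D` together with the map `N` from formulae (lambda-types)
to objects of `D` is logically distributive. That `N (A ∧ B)` is the product of `N A` and `N B`
(and similarly for the other connectives) is expressed by the universal property. -/
structure LogicallyDistributiveData (N : Formula Sg → D) where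
  hasFiniteProducts : HasFiniteProducts D
  hasFiniteCoproducts : HasFiniteCoproducts D
  hasExponentials : ∀ A B : D, ∃ (E : D) (ev : E ⨯ A ⟶ B), IsExponential A B E ev
  distributive : ∀ A B C : D, IsIso (coprod.desc (prod.map (𝟙 A) coprod.inl)
    (prod.map (𝟙 A) coprod.inr) : (A ⨯ B) ⨿ (A ⨯ C) ⟶ A ⨯ (B ⨿ C))
  hasTerminal_forall : ∀ (x : Var Sg) (A : Formula Sg), HasTerminal (ForallCat N x A)
  hasInitial_exists : ∀ (x : Var Sg) (A : Formula Sg), HasInitial (ExistsCat N x A)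
  botInitial : IsInitial (N .bot)
  topTerminal : IsTerminal (N .top)
  fst : ∀ A B : Formula Sg, N (.and A B) ⟶ N A
  snd : ∀ A B : Formula Sg, N (.and A B) ⟶ N B
  andProduct : ∀ A B : Formula Sg, IsLimit (BinaryFan.mk (fst A B) (snd A B))
  inl : ∀ A B : Formula Sg, N A ⟶ N (.or A B)
  inr : ∀ A B : Formula Sg, N B ⟶ N (.or A B)
  orCoproduct : ∀ A B : Formula Sg, IsColimit (BinaryCofan.mk (inl A B) (inr A B))
  ev : ∀ A B : Formula Sg, N (.imp A B) ⨯ N A ⟶ N B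
  impExponential : ∀ A B : Formula Sg, IsExponential (N A) (N B) (N (.imp A B)) (ev A B)
  allProj : ∀ (x : Var Sg) (A : Formula Sg) (t : Term Sg x.sort), N (.all x A) ⟶ N (A.inst x t)
  allTerminal : ∀ (x : Var Sg) (A : Formula Sg), IsTerminal (forallObj N x A (allProj x A))
  exInj : ∀ (x : Var Sg) (A : Formula Sg) (t : Term Sg x.sort), N (A.inst x t) ⟶ N (.ex x A)
  exInitial : ∀ (x : Var Sg) (A : Formula Sg), IsInitial (existsObj N x A (exInj x A))

namespace LogicallyDistributiveData

variable {N : Formula Sg → D} (L : LogicallyDistributiveData N)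

/-- The arrow `1 × δ_t : N A × N (B[t/x]) ⟶ N A × N (∃ x. B)`, where `x` is not free in `A`,
`N A × N (B[t/x])` is `N ((A ∧ B)[t/x])`, `N A × N (∃ x. B)` is `N (A ∧ ∃ x. B)` and `δ_t` is the
canonical injection. -/
def frobeniusInj (x : Var Sg) (A B : Formula Sg) (hx : x ∉ A.FV) (t : Term Sg x.sort) :
    N ((Formula.and A B).inst x t) ⟶ N (.and A (.ex x B)) :=
  (L.andProduct A (.ex x B)).lift (BinaryFan.mk
    (L.fst (A.inst x t) (B.inst x t) ≫ eqToHom (congrArg N (Formula.inst_of_notMem hx t)))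
    (L.snd (A.inst x t) (B.inst x t) ≫ L.exInj x B t))

/-- `N A × N (∃ x. B)`, where `x` is not free in `A`, as an object of `D_(∃ x. A ∧ B)`. -/
def frobeniusObj (x : Var Sg) (A B : Formula Sg) (hx : x ∉ A.FV) :
    ExistsCat N x (.and A B) where
  cocone := Cofan.mk (N (.and A (.ex x B))) (L.frobeniusInj x A B hx)
  exists_pt := ⟨.and A (.ex x B), by simp [Formula.FV, hx], rfl⟩

/-- The unique arrow `N (∃ x. A ∧ B) ⟶ N A × N (∃ x. B)` of `D_(∃ x. A ∧ B)`, where `x` is not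
free in `A`. -/
def frobeniusArrow (x : Var Sg) (A B : Formula Sg) (hx : x ∉ A.FV) :
    N (.ex x (.and A B)) ⟶ N (.and A (.ex x B)) :=
  ((L.exInitial x (.and A B)).to (L.frobeniusObj x A B hx)).hom.hom

end LogicallyDistributiveData

/-- The category `D` together with the map `N` is logically distributive. -/
def IsLogicallyDistributive (N : Formula Sg → D) : Prop :=
  ∃ L : LogicallyDistributiveData N, ∀ (x : Var Sg) (A B : Formula Sg) (hx : x ∉ A.FV),
    IsIso (L.frobeniusArrow x A B hx)

end LogicallyDistributive

/-! ### Heyting categories -/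

/-- Heyting categories: finite limits, images that are stable under pullback, finite joins of
subobjects that are preserved by the pullback functors, and right adjoints of the pullback
functors between the posets of subobjects. -/
class HeytingCategory (C : Type v) [Category.{w} C] : Prop
    extends HasFiniteLimits C, HasImages C where
  image_stable : ∀ {P A B X : C} {g' : P ⟶ A} {f' : P ⟶ X} {f : A ⟶ B} {g : X ⟶ B},
    IsPullback g' f' f g →
      imageSubobject f' = (Subobject.pullback g).obj (imageSubobject f)
  exists_bot : ∀ X : C, ∃ b : Subobject X, IsBot b
  exists_sup : ∀ {X : C} (a b : Subobject X), ∃ j : Subobject X, IsLUB {a, b} j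
  pullback_bot : ∀ {X Y : C} (f : X ⟶ Y) (b : Subobject Y), IsBot b →
    IsBot ((Subobject.pullback f).obj b)
  pullback_sup : ∀ {X Y : C} (f : X ⟶ Y) (a b j : Subobject Y), IsLUB {a, b} j →
    IsLUB {(Subobject.pullback f).obj a, (Subobject.pullback f).obj b}
      ((Subobject.pullback f).obj j)
  pullback_isLeftAdjoint : ∀ {X Y : C} (f : X ⟶ Y), (Subobject.pullback f).IsLeftAdjoint

section Heyting

variable {C : Type v} [Category.{w} C] [HeytingCategory C]

/-- The least subobject. -/
def subBot (X : C) : Subobject X := (HeytingCategory.exists_bot X).choose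

theorem subBot_le {X : C} (a : Subobject X) : subBot X ≤ a :=
  (HeytingCategory.exists_bot X).choose_spec a

/-- The join of two subobjects. -/
def subSup {X : C} (a b : Subobject X) : Subobject X := (HeytingCategory.exists_sup a b).choose

theorem subSup_isLUB {X : C} (a b : Subobject X) : IsLUB {a, b} (subSup a b) :=
  (HeytingCategory.exists_sup a b).choose_spec

/-- The functor `∀_f`, right adjoint to the pullback functor along `f`. -/
def subForall {X Y : C} (f : X ⟶ Y) : Subobject X ⥤ Subobject Y :=
  haveI := HeytingCategory.pullback_isLeftAdjoint f
  (Subobject.pullback f).rightAdjoint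

theorem le_subForall_iff {X Y : C} (f : X ⟶ Y) (a : Subobject X) (b : Subobject Y) :
    b ≤ (subForall f).obj a ↔ (Subobject.pullback f).obj b ≤ a :=
  haveI := HeytingCategory.pullback_isLeftAdjoint f
  ((Adjunction.ofIsLeftAdjoint (Subobject.pullback f)).gc b a).symm

/-- The implication of the Heyting algebra of subobjects (see `le_subImp_iff`). -/
def subImp {X : C} (a b : Subobject X) : Subobject X :=
  (subForall a.arrow).obj ((Subobject.pullback a.arrow).obj b)

theorem le_subImp_iff {X : C} (a b c : Subobject X) : c ≤ subImp a b ↔ a ⊓ c ≤ b := by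
  rw [subImp, le_subForall_iff, Subobject.inf_eq_map_pullback]
  exact ((Subobject.mapPullbackAdj a.arrow).gc _ _).symm

/-! ### Structures in a Heyting category -/

/-- A structure for the signature `Sg` in a Heyting category `C`. -/
structure HStructure (Sg : LogicalSignature.{u}) (C : Type v) [Category.{w} C]
    [HeytingCategory C] where
  sort : Sg.Srt → C
  fn : (f : Sg.Fn) → (∏ᶜ fun i => sort (Sg.fnDom f i)) ⟶ sort (Sg.fnCod f)
  rel : (r : Sg.Rel) → Subobject (∏ᶜ fun i => sort (Sg.relDom r i))

namespace HStructure

variable (M : HStructure Sg C)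

/-- The interpretation of a context, that is, of a finite set of variables: the product of the
interpretations of their sorts. -/
abbrev ctx (c : Finset (Var Sg)) : C := ∏ᶜ fun x : {x // x ∈ c} => M.sort x.1.sort

/-- The canonical projection from a context to a smaller one. -/
def proj {c d : Finset (Var Sg)} (h : d ⊆ c) : M.ctx c ⟶ M.ctx d :=
  Pi.lift fun x : {x // x ∈ d} => Pi.π (fun y : {y // y ∈ c} => M.sort y.1.sort) ⟨x.1, h x.2⟩

/-- The interpretation of the term-in-context `c. t`. -/
def term (c : Finset (Var Sg)) : {s : Sg.Srt} → (t : Term Sg s) → t.FV ⊆ c →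
    (M.ctx c ⟶ M.sort s)
  | _, .var x, h =>
      Pi.π (fun y : {y // y ∈ c} => M.sort y.1.sort) ⟨x, h (by simp [Term.FV])⟩
  | _, .app f ts, h => Pi.lift (fun i => term c (ts i) fun _ hy =>
      h (Finset.mem_biUnion.2 ⟨i, Finset.mem_univ _, hy⟩)) ≫ M.fn f

/-- The interpretation of the formula-in-context `c. A`. If the bound variable `x` of a quantified
formula is not in `c` then `c.erase x = c` and the clause is the pullback along the identity of
`∃_π` (or `∀_π`) of the interpretation of the body in the context `c, x`, where `π` projects `x`
away. If `x` happens to be in `c`, then the quantified formula, in which `x` is not free, is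
interpreted in the context `c` without `x` and weakened to `c`; this amounts to renaming the bound
variable. -/
def formula : (A : Formula Sg) → (c : Finset (Var Sg)) → A.FV ⊆ c → Subobject (M.ctx c)
  | .top, _, _ => ⊤
  | .bot, c, _ => subBot (M.ctx c)
  | .rel r ts, c, h => (Subobject.pullback (Pi.lift fun i => M.term c (ts i) fun _ hy =>
      h (Finset.mem_biUnion.2 ⟨i, Finset.mem_univ _, hy⟩))).obj (M.rel r)
  | .and A B, c, h => formula A c (Finset.union_subset_left h) ⊓
      formula B c (Finset.union_subset_right h)
  | .or A B, c, h => subSup (formula A c (Finset.union_subset_left h))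
      (formula B c (Finset.union_subset_right h))
  | .imp A B, c, h => subImp (formula A c (Finset.union_subset_left h))
      (formula B c (Finset.union_subset_right h))
  | .all x A, c, h => (Subobject.pullback (M.proj (c.erase_subset x))).obj
      ((subForall (M.proj ((c.erase_subset x).trans (c.subset_insert x)))).obj
        (formula A (insert x c) (Finset.subset_insert_iff.2 h)))
  | .ex x A, c, h => (Subobject.pullback (M.proj (c.erase_subset x))).obj
      ((Subobject.exists (M.proj ((c.erase_subset x).trans (c.subset_insert x)))).obj
        (formula A (insert x c) (Finset.subset_insert_iff.2 h)))

/-- The sequent `φ ⊢_c ψ` is valid in `M`. -/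
def Valid (c : Finset (Var Sg)) (φ ψ : Formula Sg) (hφ : φ.FV ⊆ c) (hψ : ψ.FV ⊆ c) : Prop :=
  M.formula φ c hφ ≤ M.formula ψ c hψ

/-! ### The associated logically distributive category -/

/-- The interpretation of `φ` in the context `FV(φ)`, as a subobject of the interpretation of
that context. -/
def denote (φ : Formula Sg) : Σ c : Finset (Var Sg), Subobject (M.ctx c) :=
  ⟨φ.FV, M.formula φ φ.FV subset_rfl⟩

/-- The objects of `LD(M)` are the interpretations of formulae in the contexts of their
free variables. -/
def LDObj : Type (max u v w) :=
  {X : Σ c : Finset (Var Sg), Subobject (M.ctx c) // ∃ φ : Formula Sg, M.denote φ = X}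

/-- The map from formulae to the objects of `LD(M)`. -/
def ldMap (φ : Formula Sg) : M.LDObj := ⟨M.denote φ, φ, rfl⟩

/-- There is an arrow in `LD(M)` from the interpretation of `φ` to that of `ψ` exactly when the
interpretation of `φ` is contained in that of `ψ` in the context `FV(φ) ∪ FV(ψ)`. -/
def LDLe (X Y : M.LDObj) : Prop :=
  ∃ φ ψ : Formula Sg, M.ldMap φ = X ∧ M.ldMap ψ = Y ∧
    M.formula φ (φ.FV ∪ ψ.FV) Finset.subset_union_left ≤
      M.formula ψ (φ.FV ∪ ψ.FV) Finset.subset_union_right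

/-- The category `LD(M)`: there is at most one arrow between two objects, identities are given by
reflexivity and composition by transitivity. -/
abbrev ldCategory (hrefl : ∀ X : M.LDObj, M.LDLe X X)
    (htrans : ∀ X Y Z : M.LDObj, M.LDLe X Y → M.LDLe Y Z → M.LDLe X Z) :
    Category.{max u v w} M.LDObj :=
  letI : Preorder M.LDObj :=
    { le := M.LDLe
      le_refl := hrefl
      le_trans := htrans }
  Preorder.smallCategory M.LDObj

/-- Every sort is interpreted by a well-supported object: the image of `M s ⟶ 1` is the whole of
the terminal object. -/
def WellSupported : Prop :=
  ∀ s : Sg.Srt, imageSubobject (terminal.from (M.sort s)) = ⊤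

end HStructure

end Heyting

end LogDist

end

open LogDist

noncomputable section

namespace LogDist

/-! ### Subobjects in a Heyting category: Beck-Chevalley conditions and descent along covers. -/

section HeytingFacts

variable {C : Type v} [Category.{w} C]

/-! The crux is that validity does not depend on the context. Weakening by a variable pulls back
along a projection that is itself a pullback of `M s ⟶ 1`. As `M s` is well-supported and images are
stable, this projection has full image, and pulling back along such an arrow reflects the order
(`le_of_pullback_le`). Hence an arrow of `LD(M)` can be tested in any context containing the free
variables (`ldLe_iff`). This gives (B) and transitivity, and turns the propositional connectives
into the operations of a single Heyting algebra of subobjects.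

For the quantifiers, the adjunctions reduce `E ⊢ ∀ x. A`, with `x` not free in `E`, to `E ⊢ A` in
the context extended by `x`. This is equivalent to all the `E ⊢ A[t/x]`: substitution is a pullback
(`formula_subst`, resting on Beck-Chevalley), and conversely the instance at `t = x` is `A` itself.
The existential case is dual.

The category is thin, so diagrams commute automatically and (A) becomes a set of inequalities, the
`EntailmentRules`. Distributivity and the Frobenius condition follow because conjunction with `A`
has a right adjoint. -/

theorem le_pullback_iff_factors [HasPullbacks C] {X Y : C} (f : X ⟶ Y) (a : Subobject X)
    (b : Subobject Y) : a ≤ (Subobject.pullback f).obj b ↔ b.Factors (a.arrow ≫ f) := by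
  constructor
  · intro h
    refine (Subobject.factors_iff _ _).2 ⟨Subobject.ofLE _ _ h ≫ Subobject.pullbackπ f b, ?_⟩
    change (_ ≫ _) ≫ b.arrow = _
    rw [Category.assoc, (Subobject.isPullback f b).w, ← Category.assoc, Subobject.ofLE_arrow]
  · intro h
    exact Subobject.le_of_comm ((Subobject.isPullback f b).lift (b.factorThru _ h) a.arrow
      (by simp)) (by simp)

theorem imageSubobject_le_iff [HasImages C] {X Y : C} (f : X ⟶ Y) (b : Subobject Y) :
    imageSubobject f ≤ b ↔ b.Factors f := by
  constructor
  · intro h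
    have := Subobject.factors_comp_arrow
      (factorThruImageSubobject f ≫ Subobject.ofLE _ _ h)
    simpa using this
  · intro h
    exact imageSubobject_le f (b.factorThru f h) (by simp)

theorem exists_le_iff [HasPullbacks C] [HasImages C] {X Y : C} (f : X ⟶ Y) (a : Subobject X)
    (b : Subobject Y) :
    (Subobject.exists f).obj a ≤ b ↔ a ≤ (Subobject.pullback f).obj b :=
  (Subobject.existsPullbackAdj f).gc a b

theorem exists_obj_eq_imageSubobject [HasPullbacks C] [HasImages C] {X Y : C} (f : X ⟶ Y)
    (a : Subobject X) : (Subobject.exists f).obj a = imageSubobject (a.arrow ≫ f) :=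
  eq_of_forall_ge_iff fun b => by
    rw [exists_le_iff, le_pullback_iff_factors, imageSubobject_le_iff]

variable [HeytingCategory C]

theorem pullback_mono {X Y : C} (f : X ⟶ Y) {a b : Subobject Y} (h : a ≤ b) :
    (Subobject.pullback f).obj a ≤ (Subobject.pullback f).obj b :=
  (Subobject.pullback f).monotone h

/-- The Beck-Chevalley condition for images. -/
theorem pullback_exists {P X Y Z : C} {p : P ⟶ X} {q : P ⟶ Z} {f : X ⟶ Y} {g : Z ⟶ Y}
    (h : IsPullback p q f g) (a : Subobject X) :
    (Subobject.pullback g).obj ((Subobject.exists f).obj a) =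
      (Subobject.exists q).obj ((Subobject.pullback p).obj a) := by
  rw [exists_obj_eq_imageSubobject, exists_obj_eq_imageSubobject]
  -- Pasting the square that defines the pullback of `a` along `p` onto the given one shows that the
  -- two arrows whose images are compared form a pullback square over `g`.
  exact (HeytingCategory.image_stable ((Subobject.isPullback p a).paste_vert h)).symm

/-- The Beck-Chevalley condition for the right adjoints of the pullback functors. -/
theorem pullback_subForall {P X Y Z : C} {p : P ⟶ X} {q : P ⟶ Z} {f : X ⟶ Y} {g : Z ⟶ Y}
    (h : IsPullback p q f g) (a : Subobject X) :
    (Subobject.pullback g).obj ((subForall f).obj a) =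
      (subForall q).obj ((Subobject.pullback p).obj a) :=
  eq_of_forall_le_iff fun b => by
    -- Passing to left adjoints on both sides leaves the condition for images, on the flipped
    -- square.
    rw [le_subForall_iff, ← exists_le_iff, ← exists_le_iff, le_subForall_iff,
      pullback_exists h.flip]

/-- Pulling back along an arrow whose image is everything reflects the order. -/
theorem le_of_pullback_le {X Y : C} (f : X ⟶ Y) (hf : imageSubobject f = ⊤)
    {a b : Subobject Y}
    (h : (Subobject.pullback f).obj a ≤ (Subobject.pullback f).obj b) : a ≤ b := by
  have hp := Subobject.isPullback f a
  have him : imageSubobject (Subobject.pullbackπ f a) = ⊤ := by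
    rw [HeytingCategory.image_stable hp.flip, hf, Subobject.pullback_top]
  rw [le_pullback_iff_factors, ← hp.w] at h
  -- The arrow from the pullback of `a` to `a` lands in `b` viewed as a subobject of `a`; having
  -- full image, it forces that subobject to be everything.
  have h' : ((Subobject.pullback a.arrow).obj b).Factors (Subobject.pullbackπ f a) := by
    refine (Subobject.factors_iff _ _).2
      ⟨(Subobject.isPullback a.arrow b).lift (b.factorThru _ h) (Subobject.pullbackπ f a)
        (by simp), ?_⟩
    exact (Subobject.isPullback a.arrow b).lift_snd _ _ _
  rw [← imageSubobject_le_iff, him, le_pullback_iff_factors, ← imageSubobject_le_iff] at h'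
  refine le_trans ?_ h'
  refine Subobject.le_of_comm (inv (⊤ : Subobject (a : C)).arrow ≫ factorThruImageSubobject _) ?_
  simp

theorem imageSubobject_eq_top_of_isPullback {P X Y Z : C} {p : P ⟶ X} {q : P ⟶ Z} {f : X ⟶ Y}
    {g : Z ⟶ Y} (h : IsPullback p q f g) (hf : imageSubobject f = ⊤) :
    imageSubobject q = ⊤ := by
  rw [HeytingCategory.image_stable h, hf, Subobject.pullback_top]

theorem pullback_inf {X Y : C} (f : X ⟶ Y) (a b : Subobject Y) :
    (Subobject.pullback f).obj (a ⊓ b) =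
      (Subobject.pullback f).obj a ⊓ (Subobject.pullback f).obj b :=
  eq_of_forall_le_iff fun c => by
    rw [← exists_le_iff, le_inf_iff, le_inf_iff, exists_le_iff, exists_le_iff]

theorem pullback_subBot {X Y : C} (f : X ⟶ Y) :
    (Subobject.pullback f).obj (subBot Y) = subBot X :=
  le_antisymm (HeytingCategory.pullback_bot f _ (fun b => subBot_le b) _) (subBot_le _)

theorem subSup_le_iff {X : C} (a b c : Subobject X) : subSup a b ≤ c ↔ a ≤ c ∧ b ≤ c := by
  rw [isLUB_le_iff (subSup_isLUB a b)]
  simp [upperBounds]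

theorem pullback_subSup {X Y : C} (f : X ⟶ Y) (a b : Subobject Y) :
    (Subobject.pullback f).obj (subSup a b) =
      subSup ((Subobject.pullback f).obj a) ((Subobject.pullback f).obj b) :=
  (HeytingCategory.pullback_sup f a b _ (subSup_isLUB a b)).unique (subSup_isLUB _ _)

/-- Implication is `∀` along `a.arrow`, so this is Beck-Chevalley for the square defining the
pullback of `a` along `f`. -/
theorem pullback_subImp {X Y : C} (f : X ⟶ Y) (a b : Subobject Y) :
    (Subobject.pullback f).obj (subImp a b) =
      subImp ((Subobject.pullback f).obj a) ((Subobject.pullback f).obj b) := by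
  rw [subImp, pullback_subForall (Subobject.isPullback f a), subImp, ← Subobject.pullback_comp,
    ← Subobject.pullback_comp, (Subobject.isPullback f a).w]

end HeytingFacts

/-! ### From the rules of intuitionistic logic to logical distributivity. -/

section AbstractOrder

variable {Sg : LogicalSignature.{u}}

/-- The order-theoretic rules of intuitionistic first-order logic for a map from formulae to a
preorder. -/
structure EntailmentRules {P : Type v} [Preorder P] (N : Formula Sg → P) : Prop where
  surj : Function.Surjective N
  le_top : ∀ A, N A ≤ N .top
  bot_le : ∀ A, N .bot ≤ N A
  le_and : ∀ A B E, N E ≤ N (.and A B) ↔ N E ≤ N A ∧ N E ≤ N B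
  or_le : ∀ A B E, N (.or A B) ≤ N E ↔ N A ≤ N E ∧ N B ≤ N E
  le_imp : ∀ A B E, N E ≤ N (.imp A B) ↔ N (.and E A) ≤ N B
  le_all : ∀ x A E, x ∉ E.FV → (N E ≤ N (.all x A) ↔ ∀ t, N E ≤ N (A.inst x t))
  ex_le : ∀ x A E, x ∉ E.FV → (N (.ex x A) ≤ N E ↔ ∀ t, N (A.inst x t) ≤ N E)

namespace EntailmentRules

variable {P : Type v} [Preorder P] {N : Formula Sg → P} (R : EntailmentRules N)

include R

theorem and_le_left (A B : Formula Sg) : N (.and A B) ≤ N A := ((R.le_and A B _).1 le_rfl).1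

theorem and_le_right (A B : Formula Sg) : N (.and A B) ≤ N B := ((R.le_and A B _).1 le_rfl).2

theorem le_or_left (A B : Formula Sg) : N A ≤ N (.or A B) := ((R.or_le A B _).1 le_rfl).1

theorem le_or_right (A B : Formula Sg) : N B ≤ N (.or A B) := ((R.or_le A B _).1 le_rfl).2

theorem imp_and_le (A B : Formula Sg) : N (.and (.imp A B) A) ≤ N B :=
  (R.le_imp A B _).1 le_rfl

theorem all_le (x : Var Sg) (A : Formula Sg) (t : Term Sg x.sort) :
    N (.all x A) ≤ N (A.inst x t) :=
  (R.le_all x A (.all x A) (by simp [Formula.FV])).1 le_rfl t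

theorem le_ex (x : Var Sg) (A : Formula Sg) (t : Term Sg x.sort) :
    N (A.inst x t) ≤ N (.ex x A) :=
  (R.ex_le x A (.ex x A) (by simp [Formula.FV])).1 le_rfl t

/-- Conjunction with `A` is a left adjoint; this is why it commutes with disjunctions and
existential quantifiers. -/
theorem and_le_iff (A B E : Formula Sg) : N (.and A B) ≤ N E ↔ N B ≤ N (.imp A E) := by
  rw [R.le_imp]
  have h : ∀ A B, N (.and A B) ≤ N (.and B A) := fun A B =>
    (R.le_and _ _ _).2 ⟨R.and_le_right _ _, R.and_le_left _ _⟩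
  exact ⟨(h _ _).trans, (h _ _).trans⟩

theorem and_or_le (A B E : Formula Sg) :
    N (.and A (.or B E)) ≤ N (.or (.and A B) (.and A E)) := by
  rw [R.and_le_iff, R.or_le, ← R.and_le_iff, ← R.and_le_iff]
  exact ⟨R.le_or_left _ _, R.le_or_right _ _⟩

theorem and_ex_le (x : Var Sg) (A B : Formula Sg) (hx : x ∉ A.FV) :
    N (.and A (.ex x B)) ≤ N (.ex x (.and A B)) := by
  rw [R.and_le_iff, R.ex_le _ _ _ (by simp [Formula.FV, hx])]
  intro t
  rw [← R.and_le_iff]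
  -- As `x` is not free in `A`, the instance of the conjunction at `t` leaves `A` unchanged.
  have h := R.le_ex x (.and A B) t
  rwa [show (Formula.and A B).inst x t = .and (A.inst x t) (B.inst x t) from rfl,
    Formula.inst_of_notMem hx] at h

/-- The product cone of a conjunction. -/
def isLimitAnd (A B : Formula Sg) :
    IsLimit (BinaryFan.mk (homOfLE (R.and_le_left A B)) (homOfLE (R.and_le_right A B))) :=
  BinaryFan.IsLimit.mk _
    (fun {T} f g => homOfLE (by
      obtain ⟨E, rfl⟩ := R.surj T
      exact (R.le_and A B E).2 ⟨leOfHom f, leOfHom g⟩))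
    (fun _ _ => Subsingleton.elim _ _) (fun _ _ => Subsingleton.elim _ _)
    (fun _ _ _ _ _ => Subsingleton.elim _ _)

/-- The coproduct cocone of a disjunction. -/
def isColimitOr (A B : Formula Sg) :
    IsColimit (BinaryCofan.mk (homOfLE (R.le_or_left A B)) (homOfLE (R.le_or_right A B))) :=
  BinaryCofan.IsColimit.mk _
    (fun {T} f g => homOfLE (by
      obtain ⟨E, rfl⟩ := R.surj T
      exact (R.or_le A B E).2 ⟨leOfHom f, leOfHom g⟩))
    (fun _ _ => Subsingleton.elim _ _) (fun _ _ => Subsingleton.elim _ _)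
    (fun _ _ _ _ _ => Subsingleton.elim _ _)

/-- The formula `⊤` is terminal. -/
def isTerminalTop : IsTerminal (N .top) :=
  IsTerminal.ofUniqueHom (fun T => homOfLE (by
    obtain ⟨E, rfl⟩ := R.surj T
    exact R.le_top E)) fun _ _ => Subsingleton.elim _ _

/-- The formula `⊥` is initial. -/
def isInitialBot : IsInitial (N .bot) :=
  IsInitial.ofUniqueHom (fun T => homOfLE (by
    obtain ⟨E, rfl⟩ := R.surj T
    exact R.bot_le E)) fun _ _ => Subsingleton.elim _ _

theorem hasFiniteProducts : HasFiniteProducts P := by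
  have : HasTerminal P := R.isTerminalTop.hasTerminal
  have : ∀ {X Y : P}, HasLimit (pair X Y) := by
    intro X Y
    obtain ⟨A, rfl⟩ := R.surj X
    obtain ⟨B, rfl⟩ := R.surj Y
    exact ⟨⟨⟨_, R.isLimitAnd A B⟩⟩⟩
  have : HasBinaryProducts P := hasBinaryProducts_of_hasLimit_pair P
  exact hasFiniteProducts_of_has_binary_and_terminal

theorem hasFiniteCoproducts : HasFiniteCoproducts P := by
  have : HasInitial P := R.isInitialBot.hasInitial
  have : ∀ {X Y : P}, HasColimit (pair X Y) := by
    intro X Y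
    obtain ⟨A, rfl⟩ := R.surj X
    obtain ⟨B, rfl⟩ := R.surj Y
    exact ⟨⟨⟨_, R.isColimitOr A B⟩⟩⟩
  have : HasBinaryCoproducts P := hasBinaryCoproducts_of_hasColimit_pair P
  exact hasFiniteCoproducts_of_has_binary_and_initial

/-- The chosen product need not be the object `N (.and A B)`. Surjectivity names it by a formula, to
which the rules then apply. -/
theorem prod_le_and [HasFiniteProducts P] (A B : Formula Sg) : (N A ⨯ N B) ≤ N (.and A B) := by
  obtain ⟨E, hE⟩ := R.surj (N A ⨯ N B)
  rw [← hE, R.le_and, hE]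
  exact ⟨leOfHom prod.fst, leOfHom prod.snd⟩

theorem and_le_prod [HasFiniteProducts P] (A B : Formula Sg) : N (.and A B) ≤ (N A ⨯ N B) :=
  leOfHom (prod.lift (homOfLE (R.and_le_left A B)) (homOfLE (R.and_le_right A B)))

theorem coprod_le_or [HasFiniteCoproducts P] (A B : Formula Sg) :
    (N A ⨿ N B) ≤ N (.or A B) :=
  leOfHom (coprod.desc (homOfLE (R.le_or_left A B)) (homOfLE (R.le_or_right A B)))

theorem or_le_coprod [HasFiniteCoproducts P] (A B : Formula Sg) :
    N (.or A B) ≤ (N A ⨿ N B) := by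
  obtain ⟨E, hE⟩ := R.surj (N A ⨿ N B)
  rw [← hE, R.or_le, hE]
  exact ⟨leOfHom coprod.inl, leOfHom coprod.inr⟩

theorem imp_prod_le [HasFiniteProducts P] (A B : Formula Sg) : (N (.imp A B) ⨯ N A) ≤ N B :=
  (R.prod_le_and _ _).trans (R.imp_and_le A B)

theorem isExponential_imp [HasFiniteProducts P] (A B : Formula Sg)
    (ev : N (.imp A B) ⨯ N A ⟶ N B) : IsExponential (N A) (N B) (N (.imp A B)) ev := by
  intro X f
  obtain ⟨E, rfl⟩ := R.surj X
  exact ⟨homOfLE ((R.le_imp A B E).2 ((R.and_le_prod E A).trans (leOfHom f))),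
    Subsingleton.elim _ _, fun _ _ => Subsingleton.elim _ _⟩

/-- The cone of the instances of a universally quantified formula is terminal. -/
def isTerminalForall (x : Var Sg) (A : Formula Sg) :
    IsTerminal (forallObj N x A fun t => homOfLE (R.all_le x A t)) :=
  IsTerminal.ofUniqueHom
    (fun X =>
      { hom :=
          { hom := homOfLE (by
              obtain ⟨E, hE, hX⟩ := X.exists_pt
              change X.cone.pt ≤ N (.all x A)
              rw [hX, R.le_all x A E hE]
              intro t
              rw [← hX]
              exact leOfHom (X.cone.π.app ⟨t⟩))
            w := fun _ => Subsingleton.elim _ _ }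
        property := Or.inl rfl })
    (fun X m => by
      obtain ⟨m, _⟩ := m
      congr 1)

/-- The cocone of the instances of an existentially quantified formula is initial. -/
def isInitialExists (x : Var Sg) (A : Formula Sg) :
    IsInitial (existsObj N x A fun t => homOfLE (R.le_ex x A t)) :=
  IsInitial.ofUniqueHom
    (fun X =>
      { hom :=
          { hom := homOfLE (by
              obtain ⟨E, hE, hX⟩ := X.exists_pt
              change N (.ex x A) ≤ X.cocone.pt
              rw [hX, R.ex_le x A E hE]
              intro t
              rw [← hX]
              exact leOfHom (X.cocone.ι.app ⟨t⟩))
            w := fun _ => Subsingleton.elim _ _ }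
        property := Or.inl rfl })
    (fun X m => by
      obtain ⟨m, _⟩ := m
      congr 1)

theorem distributive [HasFiniteProducts P] [HasFiniteCoproducts P] (X Y Z : P) :
    (X ⨯ (Y ⨿ Z)) ≤ ((X ⨯ Y) ⨿ (X ⨯ Z)) := by
  obtain ⟨A, rfl⟩ := R.surj X
  obtain ⟨B, rfl⟩ := R.surj Y
  obtain ⟨E, rfl⟩ := R.surj Z
  calc (N A ⨯ (N B ⨿ N E)) ≤ (N A ⨯ N (.or B E)) :=
        leOfHom (prod.map (𝟙 _) (homOfLE (R.coprod_le_or B E)))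
    _ ≤ N (.and A (.or B E)) := R.prod_le_and _ _
    _ ≤ N (.or (.and A B) (.and A E)) := R.and_or_le A B E
    _ ≤ (N (.and A B) ⨿ N (.and A E)) := R.or_le_coprod _ _
    _ ≤ ((N A ⨯ N B) ⨿ (N A ⨯ N E)) :=
        leOfHom (coprod.map (homOfLE (R.and_le_prod A B)) (homOfLE (R.and_le_prod A E)))

/-- The logically distributive structure on a preorder that satisfies the rules of intuitionistic
first-order logic. -/
def logicallyDistributiveData : LogicallyDistributiveData N :=
  letI := R.hasFiniteProducts
  letI := R.hasFiniteCoproducts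
  { hasFiniteProducts := R.hasFiniteProducts
    hasFiniteCoproducts := R.hasFiniteCoproducts
    hasExponentials := fun X Y => by
      obtain ⟨A, rfl⟩ := R.surj X
      obtain ⟨B, rfl⟩ := R.surj Y
      exact ⟨_, homOfLE (R.imp_prod_le A B), R.isExponential_imp A B _⟩
    distributive := fun X Y Z =>
      (isIso_iff_of_thin _).2 ⟨homOfLE (R.distributive X Y Z)⟩
    hasTerminal_forall := fun x A => (R.isTerminalForall x A).hasTerminal
    hasInitial_exists := fun x A => (R.isInitialExists x A).hasInitial
    botInitial := R.isInitialBot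
    topTerminal := R.isTerminalTop
    fst := fun A B => homOfLE (R.and_le_left A B)
    snd := fun A B => homOfLE (R.and_le_right A B)
    andProduct := R.isLimitAnd
    inl := fun A B => homOfLE (R.le_or_left A B)
    inr := fun A B => homOfLE (R.le_or_right A B)
    orCoproduct := R.isColimitOr
    ev := fun A B => homOfLE (R.imp_prod_le A B)
    impExponential := fun A B => R.isExponential_imp A B _
    allProj := fun x A t => homOfLE (R.all_le x A t)
    allTerminal := R.isTerminalForall
    exInj := fun x A t => homOfLE (R.le_ex x A t)
    exInitial := R.isInitialExists }

theorem isLogicallyDistributive : IsLogicallyDistributive N :=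
  ⟨R.logicallyDistributiveData, fun x A B hx =>
    (isIso_iff_of_thin _).2 ⟨homOfLE (R.and_ex_le x A B hx)⟩⟩

end EntailmentRules
end AbstractOrder

/-! ### Free variables under capture-avoiding substitution. -/

section SubstitutionSyntax

variable {Sg : LogicalSignature.{u}}

theorem Term.FV_subst_subset (σ : Subst Sg) (c : Finset (Var Sg)) :
    {s : Sg.Srt} → (t : Term Sg s) → (∀ y ∈ t.FV, (σ y).FV ⊆ c) → (t.subst σ).FV ⊆ c
  | _, .var x, h => h x (by simp [Term.FV])
  | _, .app f ts, h => by
      simp only [Term.subst, Term.FV, Finset.biUnion_subset]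
      intro i _
      exact Term.FV_subst_subset σ c (ts i) fun y hy =>
        h y (by simp only [Term.FV, Finset.mem_biUnion]; exact ⟨i, Finset.mem_univ _, hy⟩)

theorem Subst.lift_self (σ : Subst Sg) (F : Finset (Var Sg)) (x : Var Sg) :
    σ.lift F x x = Term.var ⟨x.sort, freshIdx σ F x⟩ := Function.update_self ..

theorem Subst.lift_of_ne (σ : Subst Sg) (F : Finset (Var Sg)) {x y : Var Sg} (h : y ≠ x) :
    σ.lift F x y = σ y := Function.update_of_ne h ..

theorem Subst.FV_lift_subset {σ : Subst Sg} {F c d : Finset (Var Sg)} {x : Var Sg}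
    (h : ∀ y ∈ d.erase x, (σ y).FV ⊆ c) :
    ∀ y ∈ d, (σ.lift F x y).FV ⊆ insert ⟨x.sort, freshIdx σ F x⟩ c := by
  intro y hy
  by_cases hyx : y = x
  · subst hyx
    rw [Subst.lift_self]
    simp [Term.FV]
  · rw [Subst.lift_of_ne _ _ hyx]
    exact (h y (Finset.mem_erase.2 ⟨hyx, hy⟩)).trans (Finset.subset_insert _ _)

/-- Either `x` occurs in no substituted term and is kept, or the new index exceeds every index
occurring in one. -/
theorem freshIdx_notMem (σ : Subst Sg) (F : Finset (Var Sg)) (x : Var Sg) {y : Var Sg}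
    (hy : y ∈ F) : (⟨x.sort, freshIdx σ F x⟩ : Var Sg) ∉ (σ y).FV := by
  intro h
  have hm : (⟨x.sort, freshIdx σ F x⟩ : Var Sg) ∈ F.biUnion fun y => (σ y).FV :=
    Finset.mem_biUnion.2 ⟨y, hy, h⟩
  by_cases hx : x ∈ F.biUnion fun y => (σ y).FV
  · have := Finset.le_sup (f := Var.idx) hm
    simp only [freshIdx, if_pos hx] at this
    omega
  · simp only [freshIdx, if_neg hx] at hm
    exact hx hm

theorem Formula.FV_subst_subset (A : Formula Sg) : ∀ (σ : Subst Sg) (c : Finset (Var Sg)),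
    (∀ y ∈ A.FV, (σ y).FV ⊆ c) → (A.subst σ).FV ⊆ c := by
  induction A with
  | top | bot => intros; exact Finset.empty_subset _
  | rel r ts =>
    intro σ c h
    simp only [Formula.subst, Formula.FV, Finset.biUnion_subset]
    intro i _
    exact Term.FV_subst_subset σ c (ts i) fun y hy =>
      h y (by simp only [Formula.FV, Finset.mem_biUnion]; exact ⟨i, Finset.mem_univ _, hy⟩)
  | and A B ihA ihB | or A B ihA ihB | imp A B ihA ihB =>
    intro σ c h
    simp only [Formula.FV, Finset.mem_union] at h
    exact Finset.union_subset (ihA σ c fun y hy => h y (Or.inl hy))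
      (ihB σ c fun y hy => h y (Or.inr hy))
  | all x A ih | ex x A ih =>
    intro σ c h
    exact Finset.subset_insert_iff.1 (ih _ _ (Subst.FV_lift_subset h))

theorem FV_update_var_subset {x : Var Sg} {t : Term Sg x.sort}
    {c d : Finset (Var Sg)} (hd : d ⊆ insert x c) (ht : t.FV ⊆ c) :
    ∀ y ∈ d, (Function.update Term.var x t y : Term Sg y.sort).FV ⊆ c := by
  intro y hy
  by_cases hyx : y = x
  · subst hyx
    rwa [Function.update_self]
  · rw [Function.update_of_ne hyx]
    simpa [Term.FV] using Finset.mem_of_mem_insert_of_ne (hd hy) hyx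

end SubstitutionSyntax

/-! ### Arrows between contexts and their pullback squares. -/

namespace HStructure

variable {Sg : LogicalSignature.{u}} {C : Type v} [Category.{w} C] [HeytingCategory C]
variable (M : HStructure Sg C)

/-- The arrow between contexts given by a substitution. -/
def substMap (σ : Subst Sg) (c d : Finset (Var Sg)) (h : ∀ y ∈ d, (σ y).FV ⊆ c) :
    M.ctx c ⟶ M.ctx d :=
  Pi.lift fun y : {y // y ∈ d} => M.term c (σ y.1) (h y.1 y.2)

/-- The projection of a context to one of its variables. -/
def ctxVar (c : Finset (Var Sg)) (x : Var Sg) (hx : x ∈ c) : M.ctx c ⟶ M.sort x.sort :=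
  Pi.π (fun y : {y // y ∈ c} => M.sort y.1.sort) ⟨x, hx⟩

variable {M}

theorem ctx_hom_ext {T : C} {c : Finset (Var Sg)} {f g : T ⟶ M.ctx c}
    (h : ∀ x hx, f ≫ M.ctxVar c x hx = g ≫ M.ctxVar c x hx) : f = g :=
  Pi.hom_ext _ _ fun x => h x.1 x.2

theorem term_var (c : Finset (Var Sg)) (x : Var Sg) (h : (Term.var x).FV ⊆ c) :
    M.term c (.var x) h = M.ctxVar c x (h (by simp [Term.FV])) := rfl

@[simp]
theorem substMap_ctxVar (σ : Subst Sg) (c d : Finset (Var Sg)) (h : ∀ y ∈ d, (σ y).FV ⊆ c)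
    (x : Var Sg) (hx : x ∈ d) :
    M.substMap σ c d h ≫ M.ctxVar d x hx = M.term c (σ x) (h x hx) :=
  Pi.lift_π _ _

@[simp]
theorem proj_ctxVar {c d : Finset (Var Sg)} (h : d ⊆ c) (x : Var Sg) (hx : x ∈ d) :
    M.proj h ≫ M.ctxVar d x hx = M.ctxVar c x (h hx) :=
  Pi.lift_π _ _

theorem substMap_term (σ : Subst Sg) (c d : Finset (Var Sg)) (hσ : ∀ y ∈ d, (σ y).FV ⊆ c) :
    {s : Sg.Srt} → (t : Term Sg s) → (h : t.FV ⊆ d) → (h' : (t.subst σ).FV ⊆ c) →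
      M.substMap σ c d hσ ≫ M.term d t h = M.term c (t.subst σ) h'
  | _, .var x, h, h' => substMap_ctxVar σ c d hσ x _
  | _, .app f ts, h, h' => by
      simp only [term, ← Category.assoc, Term.subst]
      congr 1
      refine Pi.hom_ext _ _ fun i => ?_
      simp only [Category.assoc, limit.lift_π, Fan.mk_pt, Fan.mk_π_app]
      exact substMap_term σ c d hσ (ts i) _ _

theorem FV_var_subset {c d : Finset (Var Sg)} (h : d ⊆ c) :
    ∀ y ∈ d, (Term.var y).FV ⊆ c := fun y hy => by simpa [Term.FV] using h hy

/-- Weakening is the identity substitution, so facts about projections are special cases of facts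
about substitutions. -/
theorem substMap_var {c d : Finset (Var Sg)} (h : d ⊆ c) :
    M.substMap Term.var c d (FV_var_subset h) = M.proj h :=
  ctx_hom_ext fun x hx => by rw [substMap_ctxVar, proj_ctxVar, term_var]

theorem proj_comp_proj {c d e : Finset (Var Sg)} (h : d ⊆ c) (h' : e ⊆ d) :
    M.proj h ≫ M.proj h' = M.proj (h'.trans h) :=
  ctx_hom_ext fun x hx => by simp

theorem proj_self (c : Finset (Var Sg)) : M.proj (subset_refl c) = 𝟙 _ :=
  ctx_hom_ext fun x hx => by simp

theorem proj_term {c d : Finset (Var Sg)} (hd : d ⊆ c) {s : Sg.Srt} (t : Term Sg s)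
    (h : t.FV ⊆ d) : M.proj hd ≫ M.term d t h = M.term c t (h.trans hd) := by
  rw [← substMap_var hd, substMap_term Term.var c d _ t h
    (by rw [Term.subst_eq_self t fun _ _ => rfl]; exact h.trans hd)]
  congr 1
  exact Term.subst_eq_self t fun _ _ => rfl

theorem proj_comp_substMap (σ : Subst Sg) {c c' d : Finset (Var Sg)} (hc : c ⊆ c')
    (h : ∀ y ∈ d, (σ y).FV ⊆ c) :
    M.proj hc ≫ M.substMap σ c d h = M.substMap σ c' d fun y hy => (h y hy).trans hc :=
  ctx_hom_ext fun x hx => by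
    rw [Category.assoc, substMap_ctxVar, substMap_ctxVar, proj_term]

theorem substMap_comp_proj (σ : Subst Sg) {c d d' : Finset (Var Sg)} (hd : d' ⊆ d)
    (h : ∀ y ∈ d, (σ y).FV ⊆ c) :
    M.substMap σ c d h ≫ M.proj hd = M.substMap σ c d' fun y hy => h y (hd hy) :=
  ctx_hom_ext fun x hx => by simp

theorem substMap_congr {σ τ : Subst Sg} {c d : Finset (Var Sg)} (h : ∀ y ∈ d, (σ y).FV ⊆ c)
    (h' : ∀ y ∈ d, (τ y).FV ⊆ c) (hστ : ∀ y ∈ d, σ y = τ y) :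
    M.substMap σ c d h = M.substMap τ c d h' :=
  ctx_hom_ext fun x hx => by
    simp only [substMap_ctxVar, hστ x hx]

/-- Extending a context by a variable is a product with the interpretation of its sort. -/
def ctxExtend {T : C} {c c' : Finset (Var Sg)} (x : Var Sg)
    (hc' : ∀ y ∈ c', y ≠ x → y ∈ c) (f : T ⟶ M.ctx c) (g : T ⟶ M.sort x.sort) :
    T ⟶ M.ctx c' :=
  Pi.lift fun y : {y // y ∈ c'} =>
    if hy : y.1 = x then g ≫ eqToHom (by rw [hy]) else f ≫ M.ctxVar c y.1 (hc' y.1 y.2 hy)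

theorem ctxExtend_self {T : C} {c c' : Finset (Var Sg)} (x : Var Sg)
    (hc' : ∀ y ∈ c', y ≠ x → y ∈ c) (f : T ⟶ M.ctx c) (g : T ⟶ M.sort x.sort) (hx : x ∈ c') :
    ctxExtend x hc' f g ≫ M.ctxVar c' x hx = g := by
  rw [ctxExtend, ctxVar, Pi.lift_π]
  simp

theorem ctxExtend_of_ne {T : C} {c c' : Finset (Var Sg)} (x : Var Sg)
    (hc' : ∀ y ∈ c', y ≠ x → y ∈ c) (f : T ⟶ M.ctx c) (g : T ⟶ M.sort x.sort)
    {y : Var Sg} (hy : y ∈ c') (hyx : y ≠ x) :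
    ctxExtend x hc' f g ≫ M.ctxVar c' y hy = f ≫ M.ctxVar c y (hc' y hy hyx) := by
  rw [ctxExtend, ctxVar, Pi.lift_π]
  simp [hyx]

theorem ctxExtend_proj {T : C} {c c' : Finset (Var Sg)} (hc : c ⊆ c') (x : Var Sg)
    (hxc : x ∉ c) (hc' : ∀ y ∈ c', y ≠ x → y ∈ c) (f : T ⟶ M.ctx c) (g : T ⟶ M.sort x.sort) :
    ctxExtend x hc' f g ≫ M.proj hc = f :=
  ctx_hom_ext fun y hy => by
    rw [Category.assoc, proj_ctxVar, ctxExtend_of_ne _ _ _ _ _ (ne_of_mem_of_not_mem hy hxc)]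

/-- A substitution that sends a new variable to a new variable gives a pullback square. -/
theorem isPullback_substMap {c c' d d' : Finset (Var Sg)} (hc : c ⊆ c') (hd : d ⊆ d')
    (x : Var Sg) (n : ℕ) (hxd : x ∉ d) (hxd' : x ∈ d') (hd' : ∀ y ∈ d', y ≠ x → y ∈ d)
    (hxc : (⟨x.sort, n⟩ : Var Sg) ∉ c) (hxc' : (⟨x.sort, n⟩ : Var Sg) ∈ c')
    (hc' : ∀ y ∈ c', y ≠ ⟨x.sort, n⟩ → y ∈ c) (σ σ' : Subst Sg)
    (h : ∀ y ∈ d, (σ y).FV ⊆ c) (h' : ∀ y ∈ d', (σ' y).FV ⊆ c')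
    (hσ : ∀ y ∈ d, σ' y = σ y) (hσx : σ' x = Term.var ⟨x.sort, n⟩) :
    IsPullback (M.substMap σ' c' d' h') (M.proj hc) (M.proj hd) (M.substMap σ c d h) := by
  -- Up to isomorphism `σ'` is `σ` times the identity of the sort of `x`, so a cone is determined by
  -- its leg to `c` and the `x`-component of its leg to `d'`.
  refine ⟨⟨?_⟩, ⟨PullbackCone.IsLimit.mk _ (fun s => ctxExtend ⟨x.sort, n⟩ hc' s.snd
    (s.fst ≫ M.ctxVar d' x hxd')) ?_ ?_ ?_⟩⟩
  · rw [proj_comp_substMap, substMap_comp_proj]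
    exact substMap_congr _ _ hσ
  · intro s
    have hsnd : ctxExtend ⟨x.sort, n⟩ hc' s.snd (s.fst ≫ M.ctxVar d' x hxd') ≫ M.proj hc =
        s.snd := ctxExtend_proj hc _ hxc hc' _ _
    refine ctx_hom_ext fun y hy => ?_
    by_cases hyx : y = x
    · subst hyx
      rw [Category.assoc, substMap_ctxVar]
      have : M.term c' (σ' y) (h' y hy) = M.ctxVar c' ⟨y.sort, n⟩ hxc' := by
        simp only [hσx]
        rfl
      rw [this, ctxExtend_self]
    · have hyd := hd' y hy hyx
      have e := congrArg (· ≫ M.ctxVar d y hyd) s.condition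
      simp only [Category.assoc, proj_ctxVar, substMap_ctxVar] at e
      rw [e, Category.assoc, substMap_ctxVar]
      simp only [hσ y hyd]
      rw [← proj_term hc (σ y) (h y hyd), ← Category.assoc, hsnd]
  · intro s
    exact ctxExtend_proj hc _ hxc hc' _ _
  · intro s m hm₁ hm₂
    refine ctx_hom_ext fun y hy => ?_
    by_cases hyx : y = ⟨x.sort, n⟩
    · subst hyx
      rw [ctxExtend_self, ← hm₁, Category.assoc, substMap_ctxVar]
      simp only [hσx]
      rfl
    · rw [ctxExtend_of_ne _ _ _ _ _ hyx, ← hm₂, Category.assoc, proj_ctxVar]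

/-- Projecting away a variable is a pullback of the projection of its sort to the terminal
object. -/
theorem isPullback_proj_terminal {c c' : Finset (Var Sg)} (hc : c ⊆ c') (x : Var Sg)
    (hxc : x ∉ c) (hxc' : x ∈ c') (hc' : ∀ y ∈ c', y ≠ x → y ∈ c) :
    IsPullback (M.ctxVar c' x hxc') (M.proj hc) (terminal.from (M.sort x.sort))
      (terminal.from (M.ctx c)) := by
  refine ⟨⟨Subsingleton.elim _ _⟩, ⟨PullbackCone.IsLimit.mk _
    (fun s => ctxExtend x hc' s.snd s.fst) ?_ ?_ ?_⟩⟩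
  · intro s
    exact ctxExtend_self _ _ _ _ _
  · intro s
    exact ctxExtend_proj hc _ hxc hc' _ _
  · intro s m hm₁ hm₂
    refine ctx_hom_ext fun y hy => ?_
    by_cases hyx : y = x
    · subst hyx
      rw [ctxExtend_self, ← hm₁]
    · rw [ctxExtend_of_ne _ _ _ _ _ hyx, ← hm₂, Category.assoc, proj_ctxVar]

end HStructure

/-! ### Weakening and substitution for formulae. -/

namespace HStructure

variable {Sg : LogicalSignature.{u}} {C : Type v} [Category.{w} C] [HeytingCategory C]
variable {M : HStructure Sg C}

/-- The pullback square used to substitute under a quantifier. -/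
theorem isPullback_substMap_insert {c d : Finset (Var Sg)} (x : Var Sg) (n : ℕ)
    (σ σ' : Subst Sg) (h : ∀ y ∈ d.erase x, (σ y).FV ⊆ c.erase ⟨x.sort, n⟩)
    (h' : ∀ y ∈ insert x d, (σ' y).FV ⊆ insert ⟨x.sort, n⟩ c)
    (hσ : ∀ y ∈ d.erase x, σ' y = σ y) (hσx : σ' x = Term.var ⟨x.sort, n⟩) :
    IsPullback (M.substMap σ' (insert ⟨x.sort, n⟩ c) (insert x d) h')
      (M.proj ((c.erase_subset ⟨x.sort, n⟩).trans (c.subset_insert ⟨x.sort, n⟩)))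
      (M.proj ((d.erase_subset x).trans (d.subset_insert x)))
      (M.substMap σ (c.erase ⟨x.sort, n⟩) (d.erase x) h) :=
  isPullback_substMap _ _ x n (Finset.notMem_erase _ _) (Finset.mem_insert_self _ _)
    (fun _ hy hyx => Finset.mem_erase.2 ⟨hyx, Finset.mem_of_mem_insert_of_ne hy hyx⟩)
    (Finset.notMem_erase _ _) (Finset.mem_insert_self _ _)
    (fun _ hy hyx => Finset.mem_erase.2 ⟨hyx, Finset.mem_of_mem_insert_of_ne hy hyx⟩)
    σ σ' h h' hσ hσx

/-- Under the identity substitution the bound variable keeps its name, hence the index `x.idx`. -/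
theorem isPullback_proj_insert {c d : Finset (Var Sg)} (hd : d ⊆ c) (x : Var Sg) :
    IsPullback (M.proj (Finset.insert_subset_insert x hd))
      (M.proj ((c.erase_subset x).trans (c.subset_insert x)))
      (M.proj ((d.erase_subset x).trans (d.subset_insert x)))
      (M.proj (Finset.erase_subset_erase x hd)) := by
  rw [← substMap_var, ← substMap_var (Finset.erase_subset_erase x hd)]
  exact isPullback_substMap_insert x x.idx _ _ _ _ (fun _ _ => rfl) rfl

/-- Weakening: the interpretation in a larger context is a pullback. -/
theorem formula_proj (A : Formula Sg) : ∀ {c d : Finset (Var Sg)} (hd : d ⊆ c)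
    (h : A.FV ⊆ d), (Subobject.pullback (M.proj hd)).obj (M.formula A d h) =
      M.formula A c (h.trans hd) := by
  induction A with
  | top => intro c d hd h; exact Subobject.pullback_top _
  | bot => intro c d hd h; exact pullback_subBot _
  | rel r ts =>
    intro c d hd h
    simp only [formula, ← Subobject.pullback_comp]
    congr 2
    refine Pi.hom_ext _ _ fun i => ?_
    simp only [Category.assoc, limit.lift_π, Fan.mk_pt, Fan.mk_π_app, proj_term]
  | and A B ihA ihB =>
    intro c d hd h
    simp only [formula, pullback_inf, ihA, ihB]
  | or A B ihA ihB =>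
    intro c d hd h
    simp only [formula, pullback_subSup, ihA, ihB]
  | imp A B ihA ihB =>
    intro c d hd h
    simp only [formula, pullback_subImp, ihA, ihB]
  | all x A ih =>
    intro c d hd h
    simp only [formula]
    -- The projection from `c` to `d.erase x` is rerouted through `c.erase x`, where Beck-Chevalley
    -- applies.
    rw [← Subobject.pullback_comp, proj_comp_proj,
      ← proj_comp_proj (c.erase_subset x) (Finset.erase_subset_erase x hd),
      Subobject.pullback_comp, pullback_subForall (isPullback_proj_insert hd x), ih]
  | ex x A ih =>
    intro c d hd h
    simp only [formula]
    rw [← Subobject.pullback_comp, proj_comp_proj,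
      ← proj_comp_proj (c.erase_subset x) (Finset.erase_subset_erase x hd),
      Subobject.pullback_comp, pullback_exists (isPullback_proj_insert hd x), ih]

/-- The interpretation of a substitution instance is a pullback. -/
theorem formula_subst (A : Formula Sg) : ∀ (σ : Subst Sg) {c d : Finset (Var Sg)}
    (hσ : ∀ y ∈ d, (σ y).FV ⊆ c) (h : A.FV ⊆ d) (h' : (A.subst σ).FV ⊆ c),
    M.formula (A.subst σ) c h' =
      (Subobject.pullback (M.substMap σ c d hσ)).obj (M.formula A d h) := by
  induction A with
  | top => intro σ c d hσ h h'; exact (Subobject.pullback_top _).symm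
  | bot => intro σ c d hσ h h'; exact (pullback_subBot _).symm
  | rel r ts =>
    intro σ c d hσ h h'
    simp only [formula, Formula.subst, ← Subobject.pullback_comp]
    congr 2
    refine Pi.hom_ext _ _ fun i => ?_
    simp only [Category.assoc, limit.lift_π, Fan.mk_pt, Fan.mk_π_app]
    exact (substMap_term σ c d hσ (ts i) _ _).symm
  | and A B ihA ihB =>
    intro σ c d hσ h h'
    simp only [formula, Formula.subst, pullback_inf]
    rw [ihA σ hσ, ihB σ hσ]
  | or A B ihA ihB =>
    intro σ c d hσ h h'
    simp only [formula, Formula.subst, pullback_subSup]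
    rw [ihA σ hσ, ihB σ hσ]
  | imp A B ihA ihB =>
    intro σ c d hσ h h'
    simp only [formula, Formula.subst, pullback_subImp]
    rw [ihA σ hσ, ihB σ hσ]
  | all x A ih | ex x A ih =>
    intro σ c d hσ h h'
    -- The square is built over the free variables of the quantified formula, not over `d`: the new
    -- bound variable avoids only the terms substituted for those, and may occur in `σ y` for other
    -- `y ∈ d`. The second `erase` is the one in the clause of `formula` for quantifiers.
    have hF : ∀ y ∈ (A.FV.erase x).erase x,
        (σ y).FV ⊆ c.erase ⟨x.sort, freshIdx σ (A.FV.erase x) x⟩ := fun y hy =>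
      Finset.subset_erase.2 ⟨hσ y (h (Finset.mem_of_mem_erase hy)),
        freshIdx_notMem _ _ _ (Finset.mem_of_mem_erase hy)⟩
    have hF' : ∀ y ∈ insert x (A.FV.erase x), (σ.lift (A.FV.erase x) x y).FV ⊆
        insert ⟨x.sort, freshIdx σ (A.FV.erase x) x⟩ c :=
      Subst.FV_lift_subset fun y hy => by
        rw [Finset.erase_insert (Finset.notMem_erase _ _)] at hy
        exact hσ y (h hy)
    have sq := isPullback_substMap_insert (M := M) x _ σ _ hF hF'
      (fun y hy => Subst.lift_of_ne _ _ (Finset.ne_of_mem_erase hy)) (Subst.lift_self _ _ _)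
    rw [← formula_proj _ h subset_rfl, ← Subobject.pullback_comp, substMap_comp_proj]
    simp only [formula, Formula.subst]
    rw [ih _ hF' (Finset.subset_insert_iff.2 subset_rfl)]
    first
    | rw [← pullback_subForall sq]
    | rw [← pullback_exists sq]
    rw [← Subobject.pullback_comp, ← Subobject.pullback_comp, proj_comp_substMap,
      substMap_comp_proj]
    rfl

/-! ### Independence of the context, and the order on interpretations. -/

theorem imageSubobject_proj_insert (hM : M.WellSupported) {c : Finset (Var Sg)} {x : Var Sg}
    (hx : x ∉ c) : imageSubobject (M.proj (c.subset_insert x)) = ⊤ :=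
  imageSubobject_eq_top_of_isPullback
    (isPullback_proj_terminal _ x hx (Finset.mem_insert_self _ _)
      fun _ hy hyx => Finset.mem_of_mem_insert_of_ne hy hyx) (hM x.sort)

/-- If every sort is well-supported, then weakening reflects the order. -/
theorem le_of_pullback_proj_le (hM : M.WellSupported) {c d : Finset (Var Sg)} (hd : d ⊆ c)
    {a b : Subobject (M.ctx d)}
    (h : (Subobject.pullback (M.proj hd)).obj a ≤ (Subobject.pullback (M.proj hd)).obj b) :
    a ≤ b := by
  induction c using Finset.strongInduction with
  | H c ih =>
    rcases hd.eq_or_ssubset with rfl | hs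
    · simpa only [proj_self, Subobject.pullback_id] using h
    · obtain ⟨x, hxc, hxd⟩ := Finset.exists_of_ssubset hs
      have hd' : d ⊆ c.erase x := Finset.subset_erase.2 ⟨hd, hxd⟩
      have hx := imageSubobject_proj_insert hM (Finset.notMem_erase x c)
      refine ih _ (Finset.erase_ssubset hxc) hd' (le_of_pullback_le _ hx ?_)
      -- These sets are equal, but not definitionally; pulling back along the projection between
      -- their contexts avoids a transport.
      have hi : c ⊆ insert x (c.erase x) := by rw [Finset.insert_erase hxc]
      have := pullback_mono (M.proj hi) h
      simpa only [← Subobject.pullback_comp, proj_comp_proj] using this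

theorem valid_iff (hM : M.WellSupported) {c d : Finset (Var Sg)} (hd : d ⊆ c)
    {A B : Formula Sg} (hA : A.FV ⊆ d) (hB : B.FV ⊆ d) :
    M.Valid c A B (hA.trans hd) (hB.trans hd) ↔ M.Valid d A B hA hB := by
  unfold Valid
  rw [← formula_proj A hd hA, ← formula_proj B hd hB]
  exact ⟨le_of_pullback_proj_le hM hd, pullback_mono _⟩

/-- An object of `LD(M)` remembers a context and a subobject but no formula. By weakening, these
already determine the interpretation in every larger context, so the choice of a representative is
harmless. -/
theorem formula_congr_of_denote_eq {A B : Formula Sg} (h : M.denote A = M.denote B)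
    {c : Finset (Var Sg)} (hA : A.FV ⊆ c) (hB : B.FV ⊆ c) :
    M.formula A c hA = M.formula B c hB := by
  have key : ∀ (X Y : Σ c : Finset (Var Sg), Subobject (M.ctx c)) (_ : X = Y)
      (hX : X.1 ⊆ c) (hY : Y.1 ⊆ c), (Subobject.pullback (M.proj hX)).obj X.2 =
        (Subobject.pullback (M.proj hY)).obj Y.2 := by
    rintro X _ rfl _ _
    rfl
  rw [← formula_proj A hA subset_rfl, ← formula_proj B hB subset_rfl]
  exact key _ _ h hA hB

theorem ldLe_iff (hM : M.WellSupported) {A B : Formula Sg} (c : Finset (Var Sg))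
    (hA : A.FV ⊆ c) (hB : B.FV ⊆ c) :
    M.LDLe (M.ldMap A) (M.ldMap B) ↔ M.formula A c hA ≤ M.formula B c hB := by
  constructor
  · rintro ⟨A', B', hA', hB', h⟩
    have eA : M.denote A' = M.denote A := congrArg Subtype.val hA'
    have eB : M.denote B' = M.denote B := congrArg Subtype.val hB'
    have fA : A'.FV = A.FV := congrArg Sigma.fst eA
    have fB : B'.FV = B.FV := congrArg Sigma.fst eB
    have hc : A'.FV ∪ B'.FV ⊆ c := Finset.union_subset (fA ▸ hA) (fB ▸ hB)
    rw [← formula_congr_of_denote_eq eA (fA ▸ hA) hA, ← formula_congr_of_denote_eq eB (fB ▸ hB) hB]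
    exact (valid_iff hM hc _ _).2 h
  · intro h
    exact ⟨A, B, rfl, rfl, (valid_iff hM (Finset.union_subset hA hB) _ _).1 h⟩

theorem ldMap_surjective : Function.Surjective M.ldMap := fun ⟨_, A, h⟩ => ⟨A, Subtype.ext h⟩

theorem ldLe_refl (X : M.LDObj) : M.LDLe X X := by
  obtain ⟨A, rfl⟩ := ldMap_surjective X
  exact ⟨A, A, rfl, rfl, le_rfl⟩

/-- The middle formula may have free variables that occur in neither end; discarding them requires
weakening to reflect the order. -/
theorem ldLe_trans (hM : M.WellSupported) (X Y Z : M.LDObj) (h : M.LDLe X Y)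
    (h' : M.LDLe Y Z) : M.LDLe X Z := by
  obtain ⟨A, rfl⟩ := ldMap_surjective X
  obtain ⟨B, rfl⟩ := ldMap_surjective Y
  obtain ⟨E, rfl⟩ := ldMap_surjective Z
  have hA : A.FV ⊆ A.FV ∪ (B.FV ∪ E.FV) := Finset.subset_union_left
  have hB : B.FV ⊆ A.FV ∪ (B.FV ∪ E.FV) :=
    Finset.subset_union_left.trans Finset.subset_union_right
  have hE : E.FV ⊆ A.FV ∪ (B.FV ∪ E.FV) :=
    Finset.subset_union_right.trans Finset.subset_union_right
  rw [ldLe_iff hM _ hA hB] at h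
  rw [ldLe_iff hM _ hB hE] at h'
  exact (ldLe_iff hM _ hA hE).2 (h.trans h')

/-! ### Quantifier rules, and the verification of the entailment rules. -/

theorem le_formula_all_iff (hM : M.WellSupported) {x : Var Sg} {A E : Formula Sg}
    {c : Finset (Var Sg)} (hx : x ∉ E.FV) (hE : E.FV ⊆ c) (h : (Formula.all x A).FV ⊆ c) :
    M.formula E c hE ≤ M.formula (.all x A) c h ↔
      M.formula E (insert x c) (hE.trans (c.subset_insert x)) ≤
        M.formula A (insert x c) (Finset.subset_insert_iff.2 h) := by
  -- Since `c` may contain `x`, both sides are compared in `c.erase x`, where the adjunction lives;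
  -- `E` makes sense there because `x` is not free in it.
  have hE' : E.FV ⊆ c.erase x := Finset.subset_erase.2 ⟨hE, hx⟩
  rw [← formula_proj E (c.erase_subset x) hE', formula]
  constructor
  · intro H
    have H' := le_of_pullback_proj_le hM _ H
    rwa [le_subForall_iff, formula_proj] at H'
  · intro H
    refine pullback_mono _ ?_
    rwa [le_subForall_iff, formula_proj]

theorem formula_ex_le_iff (hM : M.WellSupported) {x : Var Sg} {A E : Formula Sg}
    {c : Finset (Var Sg)} (hx : x ∉ E.FV) (hE : E.FV ⊆ c) (h : (Formula.ex x A).FV ⊆ c) :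
    M.formula (.ex x A) c h ≤ M.formula E c hE ↔
      M.formula A (insert x c) (Finset.subset_insert_iff.2 h) ≤
        M.formula E (insert x c) (hE.trans (c.subset_insert x)) := by
  have hE' : E.FV ⊆ c.erase x := Finset.subset_erase.2 ⟨hE, hx⟩
  rw [← formula_proj E (c.erase_subset x) hE', formula]
  constructor
  · intro H
    have H' := le_of_pullback_proj_le hM _ H
    rwa [exists_le_iff, formula_proj] at H'
  · intro H
    refine pullback_mono _ ?_
    rwa [exists_le_iff, formula_proj]

theorem formula_inst (A : Formula Sg) (x : Var Sg) (t : Term Sg x.sort) {c : Finset (Var Sg)}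
    (ht : t.FV ⊆ c) (h : A.FV ⊆ insert x c) (h' : (A.inst x t).FV ⊆ c) :
    M.formula (A.inst x t) c h' = (Subobject.pullback (M.substMap (Function.update Term.var x t) c
      (insert x c) (FV_update_var_subset subset_rfl ht))).obj (M.formula A (insert x c) h) :=
  formula_subst A _ _ h h'

/-- Validity in a context extended by a variable, in terms of validity of all instances. -/
theorem valid_insert_iff_forall_inst (hM : M.WellSupported) {x : Var Sg} {A B : Formula Sg}
    {c : Finset (Var Sg)} (hA : A.FV ⊆ insert x c) (hB : B.FV ⊆ insert x c) :
    M.formula A (insert x c) hA ≤ M.formula B (insert x c) hB ↔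
      ∀ t, M.LDLe (M.ldMap (A.inst x t)) (M.ldMap (B.inst x t)) := by
  constructor
  · intro H t
    -- The term may have variables outside `c`, so the context is enlarged before substituting.
    have hA' : A.FV ⊆ insert x (c ∪ t.FV) :=
      hA.trans (Finset.insert_subset_insert _ Finset.subset_union_left)
    have hB' : B.FV ⊆ insert x (c ∪ t.FV) :=
      hB.trans (Finset.insert_subset_insert _ Finset.subset_union_left)
    have hAt : (A.inst x t).FV ⊆ c ∪ t.FV :=
      Formula.FV_subst_subset _ _ _ (FV_update_var_subset hA' Finset.subset_union_right)
    have hBt : (B.inst x t).FV ⊆ c ∪ t.FV :=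
      Formula.FV_subst_subset _ _ _ (FV_update_var_subset hB' Finset.subset_union_right)
    rw [ldLe_iff hM (c ∪ t.FV) hAt hBt,
      formula_inst A x t Finset.subset_union_right hA',
      formula_inst B x t Finset.subset_union_right hB']
    refine pullback_mono _ ?_
    exact (valid_iff hM (Finset.insert_subset_insert x Finset.subset_union_left) hA hB).2 H
  · intro H
    -- The instance at the variable `x` is the generic one and implies all the others.
    have e : ∀ E : Formula Sg, E.inst x (.var x) = E := fun E =>
      E.subst_eq_self fun y _ => by rw [Function.update_eq_self]
    have := H (.var x)
    rw [e, e] at this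
    exact (ldLe_iff hM _ hA hB).1 this

/-- The preorder of interpretations of formulae. -/
abbrev ldPreorder (M : HStructure Sg C) (hM : M.WellSupported) : Preorder M.LDObj where
  le := M.LDLe
  le_refl := ldLe_refl
  le_trans := ldLe_trans hM

theorem entailmentRules (hM : M.WellSupported) :
    letI := M.ldPreorder hM
    EntailmentRules M.ldMap := by
  let := M.ldPreorder hM
  have iff : ∀ {A B : Formula Sg} (c : Finset (Var Sg)) (hA : A.FV ⊆ c) (hB : B.FV ⊆ c),
      M.ldMap A ≤ M.ldMap B ↔ M.formula A c hA ≤ M.formula B c hB := ldLe_iff hM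
  have sub₁ : ∀ A B E : Formula Sg, A.FV ⊆ A.FV ∪ B.FV ∪ E.FV := fun _ _ _ =>
    Finset.subset_union_left.trans Finset.subset_union_left
  have sub₂ : ∀ A B E : Formula Sg, B.FV ⊆ A.FV ∪ B.FV ∪ E.FV := fun _ _ _ =>
    Finset.subset_union_right.trans Finset.subset_union_left
  have sub₃ : ∀ A B E : Formula Sg, E.FV ⊆ A.FV ∪ B.FV ∪ E.FV := fun _ _ _ =>
    Finset.subset_union_right
  exact
    { surj := ldMap_surjective
      le_top := fun A => (iff A.FV subset_rfl (Finset.empty_subset _)).2 le_top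
      bot_le := fun A => (iff A.FV (Finset.empty_subset _) subset_rfl).2 (subBot_le _)
      le_and := fun A B E => by
        rw [iff (B := .and A B) _ (sub₃ A B E) (Finset.union_subset (sub₁ A B E) (sub₂ A B E)),
          iff _ (sub₃ A B E) (sub₁ A B E), iff _ (sub₃ A B E) (sub₂ A B E)]
        exact le_inf_iff
      or_le := fun A B E => by
        rw [iff (A := .or A B) _ (Finset.union_subset (sub₁ A B E) (sub₂ A B E)) (sub₃ A B E),
          iff _ (sub₁ A B E) (sub₃ A B E), iff _ (sub₂ A B E) (sub₃ A B E)]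
        exact subSup_le_iff _ _ _
      le_imp := fun A B E => by
        rw [iff (B := .imp A B) _ (sub₃ A B E) (Finset.union_subset (sub₁ A B E) (sub₂ A B E)),
          iff (A := .and E A) _ (Finset.union_subset (sub₃ A B E) (sub₁ A B E)) (sub₂ A B E)]
        simp only [formula]
        rw [le_subImp_iff, inf_comm]
      le_all := fun x A E hx => by
        rw [iff (E.FV ∪ (Formula.all x A).FV) Finset.subset_union_left Finset.subset_union_right,
          le_formula_all_iff hM hx, valid_insert_iff_forall_inst hM]
        -- As `x` is not free in `E`, each instance of `E` is `E` itself, so the inequalities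
        -- between instances form a cone with vertex `E`.
        exact forall_congr' fun t => by rw [Formula.inst_of_notMem hx]; rfl
      ex_le := fun x A E hx => by
        rw [iff (E.FV ∪ (Formula.ex x A).FV) Finset.subset_union_right Finset.subset_union_left,
          formula_ex_le_iff hM hx, valid_insert_iff_forall_inst hM]
        exact forall_congr' fun t => by rw [Formula.inst_of_notMem hx]; rfl }

end HStructure
end LogDist

end

theorem proposition8p13 {Sg : LogicalSignature.{u}} {C : Type v} [Category.{w} C]
    [HeytingCategory C] (M : HStructure Sg C) (hM : M.WellSupported) :
    ∃ (hrefl : ∀ X : M.LDObj, M.LDLe X X)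
      (htrans : ∀ X Y Z : M.LDObj, M.LDLe X Y → M.LDLe Y Z → M.LDLe X Z),
      letI : Category M.LDObj := M.ldCategory hrefl htrans
      IsLogicallyDistributive M.ldMap ∧
      ∀ (c : Finset (Var Sg)) (φ ψ : Formula Sg) (hφ : φ.FV ⊆ c) (hψ : ψ.FV ⊆ c),
        M.Valid c φ ψ hφ hψ ↔ Nonempty (M.ldMap φ ⟶ M.ldMap ψ) := by
  -- The category of the statement is by definition the one attached to this preorder.
  let := M.ldPreorder hM
  refine ⟨HStructure.ldLe_refl, HStructure.ldLe_trans hM,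
    (HStructure.entailmentRules hM).isLogicallyDistributive, fun c φ ψ hφ hψ => ?_⟩
  exact (HStructure.ldLe_iff hM c hφ hψ).symm.trans ⟨fun h => ⟨homOfLE h⟩, fun ⟨f⟩ => leOfHom f⟩
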